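/- Let $G=(V,E)$ be a finite connected (simple) graph and let $1/2<\varepsilon\le 1$. Consider the voter model with confidence threshold $\varepsilon$ on $G$: the opinions $\eta_0(x)$, $x\in V$, are independent and uniformly distributed on $[0,1]$; the edges are oriented arbitrarily, and each edge $e=(x,y)$ carries a Poisson process of rate $2$ and a sequence of fair coin flips, one per arrival, with all the initial opinions, Poisson processes and coin flips independent. At an arrival on $e=(x,y)$, nothing happens if the current opinions $a$ of $x$ and $b$ of $y$ satisfy $|a-b|>\varepsilon$; otherwise $y$ adopts the opinion $a$ or $x$ adopts the opinion $b$, according to the outcome of the coin flip. Let $\eta_t:V\to[0,1]$ be the configuration of opinions at time $t\ge 0$. Then the number $|\{\eta_t(x):x\in V\}|$ of distinct opinions converges almost surely, as $t\to\infty$, to a limit $\nu_\varepsilon(G)$, and $$ P(\text{consensus}) \;=\; P(\nu_\varepsilon(G)=1)\;\ge\; 2\varepsilon-1, $$ where consensus is the event that there is a time after which all vertices share the same opinion. -/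

import Mathlib

open MeasureTheory ProbabilityTheory Filter Topology
open scoped NNReal unitInterval

namespace ThresholdVoter

variable {V : Type*}

/-- An opinion profile: every vertex holds an opinion in `[0, 1]`. -/
abbrev Config (V : Type*) := V → I

/-- An orientation of the edges of `G`: each edge is turned into an arrow (dart). -/
structure EdgeOrientation (G : SimpleGraph V) where
  dart : G.edgeSet → G.Dart
  edge_dart : ∀ e, (dart e).edge = (e : Sym2 V)

open Classical in
/-- Effect on `η` of an event on an edge oriented from `x` to `y` with coin flip `u`. If the
opinions at `x` and `y` are at distance more than `ε`, nothing happens. Otherwise `y` adopts the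
opinion of `x` if `u = true` (coin `+1`), and `x` adopts that of `y` if `u = false` (coin `-1`). -/
noncomputable def interact (ε : ℝ) (x y : V) (u : Bool) (η : Config V) : Config V :=
  if |(η x : ℝ) - (η y : ℝ)| ≤ ε then
    if u then Function.update η y (η x) else Function.update η x (η y)
  else η

/-- All vertices share the same opinion. -/
def IsConsensus (η : Config V) : Prop := ∀ x y, η x = η y

/-- Number of distinct opinions present in the configuration. -/
noncomputable def numOpinions (η : Config V) : ℕ := (Set.range η).ncard

variable (G : SimpleGraph V)

/-- The randomness of the graphical representation: the initial opinions, the interarrival times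
of the Poisson process of each edge, and the coin flips attached to the arrivals. The index
`(e, n)` stands for the arrival number `n + 1` on the edge `e`. -/
abbrev Sample := Config V × (G.edgeSet × ℕ → ℝ) × (G.edgeSet × ℕ → Bool)

instance : IsProbabilityMeasure (expMeasure 2) := isProbabilityMeasure_expMeasure two_pos

/-- The law of the randomness: initial opinions i.i.d. uniform on `[0, 1]`, interarrival times
i.i.d. exponential of parameter `2` (so that each edge carries a Poisson process of parameter
`2`), coin flips i.i.d. fair, and all of these independent. -/
noncomputable def law [Fintype V] : Measure (Sample G) :=
  (Measure.pi fun _ : V => (volume : Measure I)).prod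
    ((Measure.infinitePi fun _ : G.edgeSet × ℕ => expMeasure 2).prod
      (Measure.infinitePi fun _ : G.edgeSet × ℕ => (PMF.uniformOfFintype Bool).toMeasure))

instance [Fintype V] : IsProbabilityMeasure (law G) := by
  unfold law
  infer_instance

variable {G}

/-- The arrival time number `n + 1` on the edge `e`, where `p = (e, n)`. -/
noncomputable def arrivalTime (ω : Sample G) (p : G.edgeSet × ℕ) : ℝ :=
  ∑ k ∈ Finset.range (p.2 + 1), ω.2.1 (p.1, k)

open Classical in
/-- The arrivals up to time `t`, listed in chronological order. Almost surely there are finitely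
many and no two are simultaneous, so the default value and the order of ties are immaterial. -/
noncomputable def arrivals (ω : Sample G) (t : ℝ≥0) : List (G.edgeSet × ℕ) :=
  if h : {p | arrivalTime ω p ≤ t}.Finite then
    h.toFinset.toList.insertionSort fun p q => arrivalTime ω p ≤ arrivalTime ω q
  else []

/-- The configuration `η_t` of the voter model with confidence threshold `ε`: the interactions
of the arrivals up to time `t` are applied, in chronological order, to the initial opinions. -/
noncomputable def process (o : EdgeOrientation G) (ε : ℝ) (t : ℝ≥0) (ω : Sample G) : Config V :=
  (arrivals ω t).foldl
    (fun η p => interact ε (o.dart p.1).fst (o.dart p.1).snd (ω.2.2 p) η) ω.1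

/-- The event of an ultimate consensus. -/
def consensus (o : EdgeOrientation G) (ε : ℝ) : Set (Sample G) :=
  {ω | ∀ᶠ t in atTop, IsConsensus (process o ε t ω)}

/-- The limiting number of opinions, as `t → ∞`. -/
noncomputable def limitOpinions (o : EdgeOrientation G) (ε : ℝ) (ω : Sample G) : ℕ :=
  limUnder atTop fun t => numOpinions (process o ε t ω)

end ThresholdVoter

/-! Fix the initial opinions and the order of the arrivals, so that only the coins are random. The
process is then a time change of a discrete chain, and each interaction moves the sum of `f` over
all opinions by a jump whose sign is a fair coin not used before. Hence this sum is a bounded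
martingale for every bounded measurable `f` (`integral_total_chain`). For `f` the identity,
orthogonality of the increments bounds the expected sum of squared jumps, so the jumps tend to zero
(`ae_tendsto_chainJump`). They are differences of initial opinions or zero, hence take finitely many
values and eventually vanish. The chain therefore freezes, and as every edge rings infinitely often,
neighbours in the frozen state agree or are incompatible. Call an opinion central if it lies in `[1
- ε, ε]`: it is compatible with every opinion, so a single central opinion in the frozen state
spreads along the connected graph and forces consensus. Now take `f` to be the indicator of the
central interval. The expected number of central vertices is conserved and at most `|V|`, and off
consensus this number tends to zero. So the initial number is at most `|V|` times the conditional
probability of consensus (`card_le_mul_coinLaw_consensus`). Averaging over uniform initial opinions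
gives `2 * ε - 1`. -/

namespace ThresholdVoter

variable {V : Type*}

/-! ### A single interaction. -/

section Interact

/-- The sum of `f` over the opinions of all vertices. -/
noncomputable def total [Fintype V] (f : I → ℝ) (η : Config V) : ℝ := ∑ x, f (η x)

open Classical in
/-- The change of `total f` when `y` adopts the opinion of `x`, or zero if the opinions at `x` and
`y` are incompatible. -/
noncomputable def jump (ε : ℝ) (f : I → ℝ) (x y : V) (η : Config V) : ℝ :=
  if |(η x : ℝ) - (η y : ℝ)| ≤ ε then f (η x) - f (η y) else 0

lemma total_update [Fintype V] [DecidableEq V] (f : I → ℝ) (η : Config V) (x : V) (a : I) :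
    total f (Function.update η x a) = total f η + (f a - f (η x)) := by
  unfold total
  rw [← Finset.add_sum_erase _ _ (Finset.mem_univ x), ← Finset.add_sum_erase _ (fun z => f (η z))
    (Finset.mem_univ x), Function.update_self, Finset.sum_congr rfl (g := fun z => f (η z))]
  · ring
  · intro z hz
    rw [Function.update_of_ne (Finset.ne_of_mem_erase hz)]

/-- The coin decides only which endpoint yields, and the two outcomes change the sum by opposite
amounts. This is the source of the martingale property. -/
lemma total_interact [Fintype V] (ε : ℝ) (f : I → ℝ) (x y : V) (b : Bool) (η : Config V) :
    total f (interact ε x y b η) = total f η + (if b then 1 else -1) * jump ε f x y η := by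
  classical
  unfold interact jump
  split_ifs with h hb
  · convert total_update f η y (η x) using 1
    ring
  · convert total_update f η x (η y) using 1
    ring
  · ring
  · ring

/-- The inclusion into `ℝ` is injective, so a zero jump means that the endpoints are incompatible or
already agree. -/
lemma interact_eq_self_of_jump_eq_zero {ε : ℝ} {x y : V} {η : Config V}
    (h : jump ε (fun a => (a : ℝ)) x y η = 0) (b : Bool) : interact ε x y b η = η := by
  classical
  unfold interact
  split_ifs with h1 hb
  all_goals try rfl
  all_goals
    have hxy : η x = η y := by
      unfold jump at h
      rw [if_pos h1] at h
      exact Subtype.ext (sub_eq_zero.1 h)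
  · rw [hxy]; exact Function.update_eq_self _ _
  · rw [← hxy]; exact Function.update_eq_self _ _

lemma range_interact_subset (ε : ℝ) (x y : V) (b : Bool) (η : Config V) :
    Set.range (interact ε x y b η) ⊆ Set.range η := by
  classical
  rintro _ ⟨z, rfl⟩
  unfold interact
  split_ifs
  · by_cases hz : z = y
    · subst hz; exact ⟨x, by simp⟩
    · exact ⟨z, by simp [Function.update_of_ne hz]⟩
  · by_cases hz : z = x
    · subst hz; exact ⟨y, by simp⟩
    · exact ⟨z, by simp [Function.update_of_ne hz]⟩
  · exact ⟨z, rfl⟩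

lemma measurable_interact (ε : ℝ) (x y : V) (b : Bool) :
    Measurable (interact ε x y b : Config V → Config V) := by
  classical
  unfold interact
  refine Measurable.ite (measurableSet_le (by fun_prop) measurable_const) ?_ measurable_id
  split_ifs
  · exact measurable_pi_iff.2 fun z => by
      by_cases hz : z = y
      · subst hz; simpa using measurable_pi_apply x
      · simpa [Function.update_of_ne hz] using measurable_pi_apply z
  · exact measurable_pi_iff.2 fun z => by
      by_cases hz : z = x
      · subst hz; simpa using measurable_pi_apply y
      · simpa [Function.update_of_ne hz] using measurable_pi_apply z

lemma Measurable.interact {Ω : Type*} [MeasurableSpace Ω] {g : Ω → Config V} {c : Ω → Bool}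
    (hg : Measurable g) (hc : Measurable c) (ε : ℝ) (x y : V) :
    Measurable fun ω => interact ε x y (c ω) (g ω) := by
  have h : (fun ω => ThresholdVoter.interact ε x y (c ω) (g ω)) = fun ω =>
      if c ω = true then ThresholdVoter.interact ε x y true (g ω)
      else ThresholdVoter.interact ε x y false (g ω) := by
    funext ω
    cases c ω <;> rfl
  rw [h]
  exact Measurable.ite (hc (measurableSet_singleton true))
    ((measurable_interact ε x y true).comp hg) ((measurable_interact ε x y false).comp hg)

lemma measurableSet_isConsensus [Fintype V] : MeasurableSet {η : Config V | IsConsensus η} := by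
  have : {η : Config V | IsConsensus η} = ⋂ x, ⋂ y, {η | η x = η y} := by
    ext η; simp [IsConsensus]
  rw [this]
  exact MeasurableSet.iInter fun x => MeasurableSet.iInter fun y =>
    measurableSet_eq_fun (measurable_pi_apply x) (measurable_pi_apply y)

lemma isConsensus_iff_numOpinions_eq_one [Nonempty V] {η : Config V} :
    IsConsensus η ↔ numOpinions η = 1 := by
  unfold numOpinions
  rw [Set.ncard_eq_one]
  constructor
  · intro h
    obtain ⟨v⟩ := ‹Nonempty V›
    exact ⟨η v, Set.eq_singleton_iff_unique_mem.2 ⟨⟨v, rfl⟩, by rintro _ ⟨z, rfl⟩; exact h z v⟩⟩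
  · rintro ⟨a, ha⟩ x y
    have hx : η x ∈ ({a} : Set I) := ha ▸ ⟨x, rfl⟩
    have hy : η y ∈ ({a} : Set I) := ha ▸ ⟨y, rfl⟩
    rw [Set.mem_singleton_iff] at hx hy
    rw [hx, hy]

end Interact

/-! ### The discrete chain of configurations and its frozen states. -/

section Chain

variable {G : SimpleGraph V}

/-- The configuration after the first `k` interactions, if the arrivals come in the order
`p 0, p 1, …`, the coin flips are `u` and the initial opinions are `η`. -/
noncomputable def chain (o : EdgeOrientation G) (ε : ℝ) (p : ℕ → G.edgeSet × ℕ) (η : Config V)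
    (u : G.edgeSet × ℕ → Bool) : ℕ → Config V
  | 0 => η
  | k + 1 => interact ε (o.dart (p k).1).fst (o.dart (p k).1).snd (u (p k)) (chain o ε p η u k)

variable (o : EdgeOrientation G) (ε : ℝ) (p : ℕ → G.edgeSet × ℕ) (η : Config V)

lemma foldl_map_range_eq_chain (u : G.edgeSet × ℕ → Bool) (k : ℕ) :
    ((List.range k).map p).foldl
      (fun η p => interact ε (o.dart p.1).fst (o.dart p.1).snd (u p) η) η = chain o ε p η u k := by
  induction k with
  | zero => rfl
  | succ k ih => rw [List.range_succ, List.map_append, List.foldl_append, ih]; rfl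

lemma chain_congr {u v : G.edgeSet × ℕ → Bool} {k : ℕ} (h : ∀ j < k, u (p j) = v (p j)) :
    chain o ε p η u k = chain o ε p η v k := by
  induction k with
  | zero => rfl
  | succ k ih => simp only [chain, ih fun j hj => h j (hj.trans k.lt_succ_self), h k k.lt_succ_self]

lemma range_chain_antitone (u : G.edgeSet × ℕ → Bool) :
    Antitone fun k => Set.range (chain o ε p η u k) :=
  antitone_nat_of_succ_le fun _ => range_interact_subset ..

lemma numOpinions_chain_antitone [Finite V] (u : G.edgeSet × ℕ → Bool) :
    Antitone fun k => numOpinions (chain o ε p η u k) := fun _ _ h =>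
  Set.ncard_le_ncard (range_chain_antitone o ε p η u h) (Set.finite_range _)

lemma measurable_chain (k : ℕ) : Measurable fun u => chain o ε p η u k := by
  induction k with
  | zero => exact measurable_const
  | succ k ih => exact Measurable.interact ih (measurable_pi_apply _) ..

/-- The change of `total f` at the interaction number `k`, up to the sign given by the coin. -/
noncomputable def chainJump (f : I → ℝ) (k : ℕ) (u : G.edgeSet × ℕ → Bool) : ℝ :=
  jump ε f (o.dart (p k).1).fst (o.dart (p k).1).snd (chain o ε p η u k)

lemma total_chain_succ [Fintype V] (f : I → ℝ) (u : G.edgeSet × ℕ → Bool) (k : ℕ) :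
    total f (chain o ε p η u (k + 1)) =
      total f (chain o ε p η u k) + (if u (p k) then 1 else -1) * chainJump o ε p η f k u :=
  total_interact ..

variable {o ε p η}

/-- If the jumps of the sum of the opinions tend to zero, then the chain is eventually constant,
since the jumps are differences of initial opinions. -/
lemma eventually_chainJump_eq_zero [Finite V] {u : G.edgeSet × ℕ → Bool}
    (h : Tendsto (fun k => chainJump o ε p η (fun a => (a : ℝ)) k u) atTop (𝓝 0)) :
    ∀ᶠ k in atTop, chainJump o ε p η (fun a => (a : ℝ)) k u = 0 := by
  -- No new opinions appear, so all jumps lie in this finite set; `0` accounts for incompatible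
  -- pairs. Its nonzero elements stay away from `0`.
  set S : Set ℝ := insert 0 ((fun q : V × V => (η q.1 : ℝ) - (η q.2 : ℝ)) '' Set.univ) with hS
  have hfin : S.Finite := ((Set.toFinite _).image _).insert 0
  have hmem : ∀ k, chainJump o ε p η (fun a => (a : ℝ)) k u ∈ S := by
    intro k
    have hr : ∀ z, chain o ε p η u k z ∈ Set.range η := fun z =>
      range_chain_antitone o ε p η u (Nat.zero_le k) ⟨z, rfl⟩
    unfold chainJump jump
    split_ifs
    · obtain ⟨a, ha⟩ := hr (o.dart (p k).1).fst
      obtain ⟨b, hb⟩ := hr (o.dart (p k).1).snd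
      rw [← ha, ← hb]
      exact Set.mem_insert_of_mem _ ⟨(a, b), trivial, rfl⟩
    · exact Set.mem_insert _ _
  have hopen : (S \ {0})ᶜ ∈ 𝓝 (0 : ℝ) :=
    (hfin.subset Set.sdiff_subset).isClosed.isOpen_compl.mem_nhds (by simp)
  filter_upwards [h hopen] with k hk
  by_contra hne
  exact hk ⟨hmem k, hne⟩

/-- If the jumps eventually vanish and every edge rings infinitely often, then from some time on
the chain is constant, and neighbours agree or are incompatible. -/
lemma exists_chain_stable {u : G.edgeSet × ℕ → Bool}
    (h : ∀ᶠ k in atTop, chainJump o ε p η (fun a => (a : ℝ)) k u = 0)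
    (hp : ∀ e, ∃ᶠ k in atTop, (p k).1 = e) :
    ∃ ζ : Config V, (∀ᶠ k in atTop, chain o ε p η u k = ζ) ∧
      ∀ x y, G.Adj x y → |(ζ x : ℝ) - (ζ y : ℝ)| ≤ ε → ζ x = ζ y := by
  classical
  obtain ⟨K, hK⟩ := eventually_atTop.1 h
  have hconst : ∀ k ≥ K, chain o ε p η u k = chain o ε p η u K := by
    intro k hk
    induction k, hk using Nat.le_induction with
    | base => rfl
    | succ k hk ih => rw [← ih]; exact interact_eq_self_of_jump_eq_zero (hK k hk) _
  refine ⟨chain o ε p η u K, eventually_atTop.2 ⟨K, hconst⟩, fun x y hxy hle => ?_⟩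
  -- The edge rings again after freezing, and that ring has zero jump. Its orientation is arbitrary,
  -- whence the two cases below.
  obtain ⟨k, hkK, hk⟩ := frequently_atTop.1 (hp ⟨s(x, y), hxy⟩) K
  have h0 := hK k hkK
  have hd := o.edge_dart (p k).1
  rw [hk] at hd
  unfold chainJump at h0
  rw [hconst k hkK, hk] at h0
  unfold jump at h0
  rcases SimpleGraph.dart_edge_eq_mk'_iff'.1 hd with ⟨h1, h2⟩ | ⟨h1, h2⟩
  · rw [h1, h2, if_pos hle] at h0
    exact Subtype.ext (sub_eq_zero.1 h0)
  · rw [h1, h2, if_pos (by rwa [abs_sub_comm])] at h0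
    exact (Subtype.ext (sub_eq_zero.1 h0)).symm

/-- In a stable configuration on a connected graph, an opinion compatible with every opinion
forces consensus. -/
lemma isConsensus_of_stable (hG : G.Connected) {ζ : Config V}
    (hζ : ∀ x y, G.Adj x y → |(ζ x : ℝ) - (ζ y : ℝ)| ≤ ε → ζ x = ζ y) {v : V}
    (hv : (ζ v : ℝ) ∈ Set.Icc (1 - ε) ε) : IsConsensus ζ := by
  have key : ∀ w, ζ w = ζ v := by
    intro w
    obtain ⟨W⟩ := hG.preconnected v w
    induction W with
    | nil => rfl
    | cons hadj W ih =>
      rename_i a b c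
      have hab : ζ a = ζ b := by
        -- A point of `[1 - ε, ε]` is within `ε` of every point of `[0, 1]`. Centrality then passes
        -- to `b` through `hab`, and the induction continues along the walk.
        refine hζ a b hadj (abs_le.2 ?_)
        have h0 := (ζ b).2.1
        have h1 := (ζ b).2.2
        constructor <;> linarith [hv.1, hv.2]
      rw [ih (hab ▸ hv), hab]
  exact fun x y => (key x).trans (key y).symm

end Chain

/-! ### Martingale estimates for fixed initial opinions and arrival order. -/

section Coins

/-- The law of countably many independent fair coins. -/
noncomputable abbrev coinLaw (P : Type*) : Measure (P → Bool) :=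
  Measure.infinitePi fun _ : P => (PMF.uniformOfFintype Bool).toMeasure

lemma map_not_uniformOfFintype :
    (PMF.uniformOfFintype Bool).toMeasure.map Bool.not = (PMF.uniformOfFintype Bool).toMeasure := by
  refine Measure.ext_of_singleton fun b => ?_
  rw [Measure.map_apply (measurable_of_finite _) (measurableSet_singleton b)]
  have : Bool.not ⁻¹' {b} = {!b} := by ext c; cases b <;> cases c <;> simp
  rw [this, PMF.toMeasure_apply_singleton _ _ (measurableSet_singleton _),
    PMF.toMeasure_apply_singleton _ _ (measurableSet_singleton _)]
  simp

open Classical in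
lemma measurePreserving_flip {P : Type*} (q : P) :
    MeasurePreserving (fun u : P → Bool => Function.update u q (!u q)) (coinLaw P) (coinLaw P) := by
  have hm : ∀ i : P, Measurable (if i = q then Bool.not else id) := fun i => measurable_of_finite _
  have heq : (fun u : P → Bool => Function.update u q (!u q)) =
      fun u i => (if i = q then Bool.not else id) (u i) := by
    funext u i
    by_cases h : i = q
    · subst h; simp
    · simp [h]
  rw [heq]
  refine ⟨measurable_pi_lambda _ fun i => (hm i).comp (measurable_pi_apply i), ?_⟩
  rw [Measure.infinitePi_map_pi _ hm]
  congr 1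
  funext i
  split_ifs
  · exact map_not_uniformOfFintype
  · exact Measure.map_id

lemma measurable_sign {P : Type*} (q : P) :
    Measurable fun u : P → Bool => if u q then (1 : ℝ) else -1 := by
  have h : MeasurableSet {u : P → Bool | u q = true} :=
    measurableSet_eq_fun (measurable_pi_apply q) measurable_const
  exact Measurable.ite h measurable_const measurable_const

/-- A fair sign is orthogonal to every variable which does not depend on it. -/
lemma integral_sign_mul_eq_zero {P : Type*} (q : P) {g : (P → Bool) → ℝ} (hg : Measurable g)
    (h : ∀ u v : P → Bool, (∀ i ≠ q, u i = v i) → g u = g v) :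
    ∫ u, (if u q then 1 else -1) * g u ∂coinLaw P = 0 := by
  classical
  have hmeas : Measurable fun u : P → Bool => (if u q then 1 else -1) * g u :=
    (measurable_sign q).mul hg
  -- Flipping coin `q` preserves the law and negates the integrand, so the integral equals its own
  -- negative.
  have hflip := integral_map (measurePreserving_flip q).measurable.aemeasurable
    (hmeas.aestronglyMeasurable (μ := (coinLaw P).map fun u => Function.update u q (!u q)))
  rw [(measurePreserving_flip q).map_eq] at hflip
  have hneg : ∀ u : P → Bool, (if Function.update u q (!u q) q then (1 : ℝ) else -1) *
      g (Function.update u q (!u q)) = -((if u q then 1 else -1) * g u) := by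
    intro u
    rw [h (Function.update u q (!u q)) u fun i hi => Function.update_of_ne hi _ _,
      Function.update_self]
    cases u q <;> simp
  simp only [hneg, integral_neg] at hflip
  linarith

variable {G : SimpleGraph V} {o : EdgeOrientation G} {ε : ℝ} {p : ℕ → G.edgeSet × ℕ}
  {η : Config V} {f : I → ℝ}

lemma measurable_chainJump (hf : Measurable f) (k : ℕ) : Measurable (chainJump o ε p η f k) := by
  classical
  have hx := fun z => (measurable_pi_apply z).comp (measurable_chain o ε p η k)
  unfold chainJump jump
  exact Measurable.ite (measurableSet_le (continuous_abs.measurable.comp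
    ((measurable_subtype_coe.comp (hx _)).sub (measurable_subtype_coe.comp (hx _))))
    measurable_const) ((hf.comp (hx _)).sub (hf.comp (hx _))) measurable_const

lemma abs_chainJump_le (hf : ∀ a, |f a| ≤ 1) (k : ℕ) (u : G.edgeSet × ℕ → Bool) :
    |chainJump o ε p η f k u| ≤ 2 := by
  unfold chainJump jump
  split_ifs
  · refine (abs_sub _ _).trans ?_
    linarith [hf (chain o ε p η u k (o.dart (p k).1).fst), hf (chain o ε p η u k (o.dart (p k).1).snd)]
  · simp

lemma integrable_of_abs_le {P : Type*} {g : (P → Bool) → ℝ} (hg : Measurable g) {C : ℝ}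
    (h : ∀ u, |g u| ≤ C) : Integrable g (coinLaw P) :=
  Integrable.of_bound hg.aestronglyMeasurable C (Eventually.of_forall h)

/-- Injectivity of `p` makes the coin of step `k` fresh: no earlier step has used it. -/
lemma chain_eq_of_eq_off (hp : Function.Injective p) (k : ℕ) {u v : G.edgeSet × ℕ → Bool}
    (h : ∀ i ≠ p k, u i = v i) : chain o ε p η u k = chain o ε p η v k :=
  chain_congr o ε p η fun _ hj => h _ fun he => hj.ne (hp he)

variable [Fintype V]

lemma measurable_total (hf : Measurable f) : Measurable (total f : Config V → ℝ) :=
  Finset.measurable_sum _ fun x _ => hf.comp (measurable_pi_apply x)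

lemma abs_total_le (hf : ∀ a, |f a| ≤ 1) (η : Config V) : |total f η| ≤ Fintype.card V := by
  refine (Finset.abs_sum_le_sum_abs _ _).trans ((Finset.sum_le_sum fun x _ => hf _).trans ?_)
  simp

/-- The expected total of `f` does not change with time. -/
lemma integral_total_chain (hp : Function.Injective p) (hf : Measurable f) (hf1 : ∀ a, |f a| ≤ 1)
    (k : ℕ) : ∫ u, total f (chain o ε p η u k) ∂coinLaw (G.edgeSet × ℕ) = total f η := by
  induction k with
  | zero => simp [chain]
  | succ k ih =>
    have hm := measurable_chainJump (o := o) (ε := ε) (p := p) (η := η) hf k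
    simp only [total_chain_succ]
    rw [integral_add, ih, integral_sign_mul_eq_zero _ hm, add_zero]
    · intro u v h
      unfold chainJump
      rw [chain_eq_of_eq_off hp k h]
    · exact integrable_of_abs_le ((measurable_total hf).comp (measurable_chain o ε p η k))
        fun u => abs_total_le hf1 _
    · refine integrable_of_abs_le ((measurable_sign _).mul hm) (C := 2) fun u => ?_
      rw [abs_mul]
      have := abs_chainJump_le (o := o) (ε := ε) (p := p) (η := η) hf1 k u
      split_ifs <;> simpa using this

/-- The second moment of the total of `f` grows by the second moment of the jump. -/
lemma integral_total_chain_sq_succ (hp : Function.Injective p) (hf : Measurable f)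
    (hf1 : ∀ a, |f a| ≤ 1) (k : ℕ) :
    ∫ u, total f (chain o ε p η u (k + 1)) ^ 2 ∂coinLaw (G.edgeSet × ℕ) =
      ∫ u, total f (chain o ε p η u k) ^ 2 ∂coinLaw (G.edgeSet × ℕ) +
        ∫ u, chainJump o ε p η f k u ^ 2 ∂coinLaw (G.edgeSet × ℕ) := by
  have hm := measurable_chainJump (o := o) (ε := ε) (p := p) (η := η) hf k
  have ht : Measurable fun u => total f (chain o ε p η u k) :=
    (measurable_total hf).comp (measurable_chain o ε p η k)
  have hJ := abs_chainJump_le (o := o) (ε := ε) (p := p) (η := η) hf1 k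
  have hT : ∀ u, |total f (chain o ε p η u k)| ≤ Fintype.card V := fun u => abs_total_le hf1 _
  -- The square of the sign is `1`, and the cross term carries a fresh sign, so it integrates to
  -- zero.
  have hexp : ∀ u, total f (chain o ε p η u (k + 1)) ^ 2 =
      total f (chain o ε p η u k) ^ 2 + chainJump o ε p η f k u ^ 2 + (if u (p k) then 1 else -1) *
        (2 * total f (chain o ε p η u k) * chainJump o ε p η f k u) := by
    intro u
    rw [total_chain_succ]
    split_ifs <;> ring
  have hi1 : Integrable (fun u => total f (chain o ε p η u k) ^ 2) (coinLaw (G.edgeSet × ℕ)) :=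
    integrable_of_abs_le (ht.pow_const 2) (C := (Fintype.card V : ℝ) ^ 2) fun u => by
      rw [abs_pow]; exact pow_le_pow_left₀ (abs_nonneg _) (hT u) 2
  have hi2 : Integrable (fun u => chainJump o ε p η f k u ^ 2) (coinLaw (G.edgeSet × ℕ)) :=
    integrable_of_abs_le (hm.pow_const 2) (C := 2 ^ 2) fun u => by
      rw [abs_pow]; exact pow_le_pow_left₀ (abs_nonneg _) (hJ u) 2
  have hi3 : Integrable (fun u => (if u (p k) then 1 else -1) *
      (2 * total f (chain o ε p η u k) * chainJump o ε p η f k u)) (coinLaw (G.edgeSet × ℕ)) := by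
    refine integrable_of_abs_le ((measurable_sign _).mul ((measurable_const.mul ht).mul hm))
      (C := 2 * Fintype.card V * 2) fun u => ?_
    have h1 : |(if u (p k) then (1 : ℝ) else -1)| = 1 := by split_ifs <;> simp
    rw [abs_mul, h1, one_mul, abs_mul, abs_mul, abs_two]
    exact mul_le_mul (mul_le_mul_of_nonneg_left (hT u) zero_le_two) (hJ u) (abs_nonneg _)
      (by positivity)
  have hTJ : Measurable fun u => 2 * total f (chain o ε p η u k) * chainJump o ε p η f k u :=
    (measurable_const.mul ht).mul hm
  have hi12 : Integrable (fun u => total f (chain o ε p η u k) ^ 2 +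
      chainJump o ε p η f k u ^ 2) (coinLaw (G.edgeSet × ℕ)) := hi1.add hi2
  simp only [hexp]
  rw [integral_add hi12 hi3, integral_add hi1 hi2, integral_sign_mul_eq_zero _ hTJ, add_zero]
  intro u v h
  unfold chainJump
  rw [chain_eq_of_eq_off hp k h]

/-- Almost surely, the jumps of the total of `f` tend to zero, because the sum of their squares has
a finite expectation. -/
lemma ae_tendsto_chainJump (hp : Function.Injective p) (hf : Measurable f)
    (hf1 : ∀ a, |f a| ≤ 1) :
    ∀ᵐ u ∂coinLaw (G.edgeSet × ℕ), Tendsto (fun k => chainJump o ε p η f k u) atTop (𝓝 0) := by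
  have hm := fun k => measurable_chainJump (o := o) (ε := ε) (p := p) (η := η) hf k
  have hi : ∀ k, Integrable (fun u => chainJump o ε p η f k u ^ 2) (coinLaw (G.edgeSet × ℕ)) :=
    fun k => integrable_of_abs_le ((hm k).pow_const 2) (C := 2 ^ 2) fun u => by
      rw [abs_pow]; exact pow_le_pow_left₀ (abs_nonneg _) (abs_chainJump_le hf1 k u) 2
  have hsum : ∀ n, ∑ k ∈ Finset.range n, ∫ u, chainJump o ε p η f k u ^ 2
      ∂coinLaw (G.edgeSet × ℕ) ≤ (Fintype.card V : ℝ) ^ 2 := by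
    intro n
    -- The second moments telescope, so the uniform bound on the total bounds all partial sums.
    have heq : ∑ k ∈ Finset.range n, ∫ u, chainJump o ε p η f k u ^ 2 ∂coinLaw (G.edgeSet × ℕ) +
        total f η ^ 2 = ∫ u, total f (chain o ε p η u n) ^ 2 ∂coinLaw (G.edgeSet × ℕ) := by
      induction n with
      | zero => simp [chain]
      | succ n ih =>
        rw [Finset.sum_range_succ, integral_total_chain_sq_succ hp hf hf1, ← ih]
        ring
    have hle : ∫ u, total f (chain o ε p η u n) ^ 2 ∂coinLaw (G.edgeSet × ℕ) ≤
        ∫ _, (Fintype.card V : ℝ) ^ 2 ∂coinLaw (G.edgeSet × ℕ) := by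
      have hb : ∀ u, total f (chain o ε p η u n) ^ 2 ≤ (Fintype.card V : ℝ) ^ 2 := fun u =>
        sq_le_sq.2 ((abs_total_le hf1 _).trans (le_abs_self _))
      refine integral_mono (integrable_of_abs_le (((measurable_total hf).comp
        (measurable_chain o ε p η n)).pow_const 2) (C := (Fintype.card V : ℝ) ^ 2) fun u => ?_)
        (integrable_const _) hb
      simpa [abs_of_nonneg] using hb u
    rw [integral_const, probReal_univ, one_smul] at hle
    nlinarith [sq_nonneg (total f η)]
  have hlin : ∫⁻ u, ∑' k, ENNReal.ofReal (chainJump o ε p η f k u ^ 2)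
      ∂coinLaw (G.edgeSet × ℕ) ≠ ⊤ := by
    rw [lintegral_tsum fun k => ((hm k).pow_const 2).ennreal_ofReal.aemeasurable]
    simp_rw [← ofReal_integral_eq_lintegral_ofReal (hi _) (Eventually.of_forall fun _ => sq_nonneg _)]
    refine (Summable.tsum_ofReal_lt_top ?_).ne
    exact summable_of_sum_range_le (fun k => integral_nonneg fun _ => sq_nonneg _) hsum
  filter_upwards [ae_lt_top (Measurable.tsum fun k => ((hm k).pow_const 2).ennreal_ofReal)
    hlin] with u hu
  have hs := (ENNReal.summable_toReal hu.ne).tendsto_atTop_zero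
  simp_rw [ENNReal.toReal_ofReal (sq_nonneg _)] at hs
  have := hs.sqrt
  simp only [Real.sqrt_zero, Real.sqrt_sq_eq_abs] at this
  exact (tendsto_zero_iff_abs_tendsto_zero _).2 this

open Classical in
/-- The probability of consensus given the order of the arrivals and the initial opinions is at
least the initial fraction of opinions compatible with every opinion. -/
lemma card_le_mul_coinLaw_consensus (hG : G.Connected) (hp : Function.Injective p)
    (hpe : ∀ e, ∃ᶠ k in atTop, (p k).1 = e) :
    total (fun a => if (a : ℝ) ∈ Set.Icc (1 - ε) ε then 1 else 0) η ≤ Fintype.card V *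
      (coinLaw (G.edgeSet × ℕ)).real {u | ∃ k, IsConsensus (chain o ε p η u k)} := by
  set f : I → ℝ := fun a => if (a : ℝ) ∈ Set.Icc (1 - ε) ε then 1 else 0 with hf
  set A : Set (G.edgeSet × ℕ → Bool) := {u | ∃ k, IsConsensus (chain o ε p η u k)} with hA
  have hfm : Measurable f :=
    Measurable.ite (measurable_subtype_coe measurableSet_Icc) measurable_const measurable_const
  have hf1 : ∀ a, |f a| ≤ 1 := by intro a; simp only [hf]; split_ifs <;> simp
  have hAm : MeasurableSet A := by
    have : A = ⋃ k, (fun u => chain o ε p η u k) ⁻¹' {ζ | IsConsensus ζ} := by ext u; simp [hA]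
    rw [this]
    exact MeasurableSet.iUnion fun k => measurable_chain o ε p η k measurableSet_isConsensus
  -- Off `A` the frozen state has no central opinion, so the integrand is eventually zero; dominated
  -- convergence applies.
  have hlim : Tendsto (fun k => ∫ u, Aᶜ.indicator (fun u => total f (chain o ε p η u k)) u
      ∂coinLaw (G.edgeSet × ℕ)) atTop (𝓝 (∫ _, (0 : ℝ) ∂coinLaw (G.edgeSet × ℕ))) := by
    refine tendsto_integral_of_dominated_convergence (fun _ => (Fintype.card V : ℝ))
      (fun k => (((measurable_total hfm).comp (measurable_chain o ε p η k)).indicator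
        hAm.compl).aestronglyMeasurable) (integrable_const _)
      (fun k => Eventually.of_forall fun u => ?_) ?_
    · refine (norm_indicator_le_norm_self _ u).trans (abs_total_le hf1 _)
    · filter_upwards [ae_tendsto_chainJump (o := o) (ε := ε) (η := η) hp measurable_subtype_coe
        fun a : I => abs_le.2 ⟨by linarith [a.2.1], a.2.2⟩] with u hu
      obtain ⟨ζ, hζ, hst⟩ := exists_chain_stable (eventually_chainJump_eq_zero hu) hpe
      refine tendsto_const_nhds.congr' ?_
      filter_upwards [hζ] with k hk
      by_cases hu : u ∈ A
      · simp [hu]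
      · rw [Set.indicator_of_mem hu, hk]
        refine (Finset.sum_eq_zero fun x _ => if_neg fun hx => hu ⟨k, ?_⟩).symm
        rw [hk]
        exact isConsensus_of_stable hG hst hx
  rw [integral_zero] at hlim
  -- For each `k`, split the conserved expectation over `A`, where the total is at most `|V|`, and
  -- `Aᶜ`, whose contribution vanishes in the limit.
  refine le_of_tendsto_of_tendsto (b := atTop) tendsto_const_nhds
    (by simpa using hlim.const_add (Fintype.card V * (coinLaw (G.edgeSet × ℕ)).real A))
    (Eventually.of_forall fun k => ?_)
  have hint : Integrable (fun u => total f (chain o ε p η u k)) (coinLaw (G.edgeSet × ℕ)) :=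
    integrable_of_abs_le ((measurable_total hfm).comp (measurable_chain o ε p η k))
      fun u => abs_total_le hf1 _
  have hA_le : ∫ u in A, total f (chain o ε p η u k) ∂coinLaw (G.edgeSet × ℕ) ≤
      ∫ _ in A, (Fintype.card V : ℝ) ∂coinLaw (G.edgeSet × ℕ) :=
    integral_mono hint.integrableOn (integrable_const _) fun u =>
      (le_abs_self _).trans (abs_total_le hf1 _)
  rw [setIntegral_const, smul_eq_mul, mul_comm] at hA_le
  rw [← integral_total_chain (o := o) (ε := ε) hp hfm hf1 k, ← integral_add_compl hAm hint]
  simp only [integral_indicator hAm.compl]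
  gcongr

end Coins

/-! ### Non-explosion and absence of simultaneous arrivals. -/

section InterarrivalTimes

lemma expMeasure_singleton (r x : ℝ) : expMeasure r {x} = 0 :=
  withDensity_absolutelyContinuous volume _ Real.volume_singleton

lemma ae_expMeasure_pos : ∀ᵐ x ∂expMeasure 2, 0 < x := by
  have h := ofReal_cdf (expMeasure 2) 0
  rw [cdf_expMeasure_eq two_pos, if_pos le_rfl] at h
  rw [ae_iff]
  simpa [Set.Iic] using h.symm

lemma expMeasure_Ioi_one_ne_zero : expMeasure 2 (Set.Ioi 1) ≠ 0 := by
  intro h0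
  have h := ofReal_cdf (expMeasure 2) 1
  rw [cdf_expMeasure_eq two_pos, if_pos zero_le_one,
    (prob_compl_eq_zero_iff measurableSet_Iic).1 (by rwa [Set.compl_Iic])] at h
  have hlt : ENNReal.ofReal (1 - Real.exp (-(2 * 1))) < ENNReal.ofReal 1 :=
    (ENNReal.ofReal_lt_ofReal_iff one_pos).2 (by linarith [Real.exp_pos (-(2 * 1))])
  rw [h, ENNReal.ofReal_one] at hlt
  exact lt_irrefl _ hlt

/-- The sum of two independent variables almost surely does not vanish if one of them has no
atoms. -/
lemma measure_add_eq_zero_of_indepFun {Ω : Type*} [MeasurableSpace Ω] {μ : Measure Ω}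
    [IsProbabilityMeasure μ] {X Y : Ω → ℝ} (hX : Measurable X) (hY : Measurable Y)
    (h : IndepFun Y X μ) (hna : ∀ x, μ (X ⁻¹' {x}) = 0) : μ {ω | Y ω + X ω = 0} = 0 := by
  have hS : MeasurableSet {z : ℝ × ℝ | z.1 + z.2 = 0} :=
    measurableSet_eq_fun (measurable_fst.add measurable_snd) measurable_const
  have hmap : μ {ω | Y ω + X ω = 0} =
      (μ.map fun ω => (Y ω, X ω)) {z : ℝ × ℝ | z.1 + z.2 = 0} := by
    rw [Measure.map_apply (hY.prodMk hX) hS]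
    rfl
  rw [hmap, (indepFun_iff_map_prod_eq_prod_map_map hY.aemeasurable hX.aemeasurable).1 h,
    Measure.prod_apply hS]
  refine lintegral_eq_zero_of_ae_eq_zero (Eventually.of_forall fun y => ?_)
  have hsec : Prod.mk y ⁻¹' {z : ℝ × ℝ | z.1 + z.2 = 0} = {-y} := by
    ext x
    simp [eq_neg_iff_add_eq_zero, add_comm]
  simp only [hsec, Pi.zero_apply]
  rw [Measure.map_apply hX (measurableSet_singleton _), hna]

/-- The law of independent exponential interarrival times. -/
noncomputable abbrev timeLaw (P : Type*) : Measure (P → ℝ) :=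
  Measure.infinitePi fun _ : P => expMeasure 2

variable {E : Type*}

lemma ae_timeLaw_pos [Countable E] : ∀ᵐ τ ∂timeLaw (E × ℕ), ∀ q, 0 < τ q :=
  ae_all_iff.2 fun q =>
    (measurePreserving_eval_infinitePi (fun _ : E × ℕ => expMeasure 2) q).quasiMeasurePreserving.ae
      ae_expMeasure_pos

/-- Second Borel–Cantelli lemma, for independent events of the same positive probability. -/
lemma ae_timeLaw_frequently_gt_one (e : E) :
    ∀ᵐ τ ∂timeLaw (E × ℕ), ∃ᶠ n in atTop, 1 < τ (e, n) := by
  set s : ℕ → Set (E × ℕ → ℝ) := fun n => {τ | 1 < τ (e, n)} with hs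
  have hpre : ∀ n, s n = Function.eval (e, n) ⁻¹' Set.Ioi 1 := fun n => rfl
  have hsm : ∀ n, MeasurableSet (s n) := fun n => measurable_pi_apply _ measurableSet_Ioi
  have hind : iIndepFun (fun n (τ : E × ℕ → ℝ) => τ (e, n)) (timeLaw (E × ℕ)) :=
    (iIndepFun_infinitePi (P := fun _ : E × ℕ => expMeasure 2) (X := fun _ => id)
      fun _ => measurable_id).precomp (Prod.mk_right_injective e)
  have hset : iIndepSet s (timeLaw (E × ℕ)) :=
    (iIndepSet_iff_meas_biInter hsm).2 fun S =>
      hind.meas_biInter fun n _ => ⟨Set.Ioi 1, measurableSet_Ioi, rfl⟩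
  have hmeas : ∀ n, timeLaw (E × ℕ) (s n) = expMeasure 2 (Set.Ioi 1) := fun n => by
    rw [hpre]
    exact (measurePreserving_eval_infinitePi (fun _ : E × ℕ => expMeasure 2)
      (e, n)).measure_preimage measurableSet_Ioi.nullMeasurableSet
  have hlim := measure_limsup_eq_one hsm hset (by
    simp_rw [hmeas]
    exact ENNReal.tsum_const_eq_top_of_ne_zero expMeasure_Ioi_one_ne_zero)
  have := (mem_ae_iff_prob_eq_one (MeasurableSet.measurableSet_limsup hsm)).2 hlim
  filter_upwards [this] with τ hτ
  exact mem_limsup_iff_frequently_mem.1 hτ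

lemma ae_timeLaw_tendsto_sum [Countable E] : ∀ᵐ τ ∂timeLaw (E × ℕ), ∀ e,
    Tendsto (fun n => ∑ k ∈ Finset.range n, τ (e, k)) atTop atTop := by
  filter_upwards [ae_timeLaw_pos, ae_all_iff.2 ae_timeLaw_frequently_gt_one] with τ hpos hfreq e
  refine (not_summable_iff_tendsto_nat_atTop_of_nonneg fun n => (hpos (e, n)).le).1 fun hsum => ?_
  obtain ⟨n, hn, hn'⟩ := ((hfreq e).and_eventually
    (hsum.tendsto_atTop_zero.eventually (gt_mem_nhds one_pos))).exists
  exact hn.not_gt hn'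

open Classical in
/-- Arrivals on different edges are almost surely not simultaneous. -/
lemma timeLaw_tie_eq_zero {e e' : E} (he : e ≠ e') (n m : ℕ) :
    timeLaw (E × ℕ) {τ | ∑ k ∈ Finset.range (n + 1), τ (e, k) =
      ∑ k ∈ Finset.range (m + 1), τ (e', k)} = 0 := by
  -- The signs turn the difference of the two arrival times into a sum of independent variables. The
  -- last interarrival time on `e` is left out of `s` below, to serve as the atomless summand.
  set c : E × ℕ → ℝ := fun q => if q.1 = e then 1 else -1 with hc
  set X : E × ℕ → (E × ℕ → ℝ) → ℝ := fun q τ => c q * τ q with hX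
  have hXm : ∀ q, Measurable (X q) := fun q => measurable_const.mul (measurable_pi_apply q)
  have hind : iIndepFun X (timeLaw (E × ℕ)) :=
    iIndepFun_infinitePi (P := fun _ : E × ℕ => expMeasure 2) (X := fun q x => c q * x)
      fun q => measurable_const.mul measurable_id
  set s : Finset (E × ℕ) := (Finset.range n).image (Prod.mk e) ∪
    (Finset.range (m + 1)).image (Prod.mk e') with hs
  have hns : (e, n) ∉ s := by simp [hs, he.symm]
  have hce : ∀ k, X (e, k) = fun τ => τ (e, k) := fun k => by simp [hX, hc]
  have hce' : ∀ k, X (e', k) = fun τ => -τ (e', k) := fun k => by simp [hX, hc, he.symm]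
  refine measure_mono_null ?_ (measure_add_eq_zero_of_indepFun (hXm (e, n))
    (Y := ∑ q ∈ s, X q) (by fun_prop) (hind.indepFun_finsetSum_of_notMem hXm hns)
    fun x => ?_)
  · intro τ hτ
    have hdisj : Disjoint ((Finset.range n).image (Prod.mk e))
        ((Finset.range (m + 1)).image (Prod.mk e')) := by
      rw [Finset.disjoint_left]
      intro q hq hq'
      obtain ⟨k, -, rfl⟩ := Finset.mem_image.1 hq
      obtain ⟨k', -, h⟩ := Finset.mem_image.1 hq'
      exact he (congrArg Prod.fst h).symm
    have hτ' : ∑ k ∈ Finset.range (n + 1), τ (e, k) =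
      ∑ k ∈ Finset.range (m + 1), τ (e', k) := hτ
    rw [Finset.sum_range_succ] at hτ'
    rw [Set.mem_ofPred_eq, Finset.sum_apply, hs, Finset.sum_union hdisj,
      Finset.sum_image (Prod.mk_right_injective e).injOn,
      Finset.sum_image (Prod.mk_right_injective e').injOn]
    simp only [hce, hce', Finset.sum_neg_distrib]
    linarith
  · rw [hce]
    exact ((measurePreserving_eval_infinitePi (fun _ : E × ℕ => expMeasure 2)
      (e, n)).measure_preimage (measurableSet_singleton x).nullMeasurableSet).trans
        (expMeasure_singleton 2 x)

/-- Almost surely, the arrivals are locally finite and no two of them are simultaneous. -/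
lemma ae_timeLaw_locallyFinite_injective [Finite E] : ∀ᵐ τ ∂timeLaw (E × ℕ),
    (∀ t : ℝ, {q : E × ℕ | ∑ k ∈ Finset.range (q.2 + 1), τ (q.1, k) ≤ t}.Finite) ∧
    Function.Injective fun q : E × ℕ => ∑ k ∈ Finset.range (q.2 + 1), τ (q.1, k) := by
  have htie : ∀ᵐ τ ∂timeLaw (E × ℕ), ∀ q q' : E × ℕ, q.1 ≠ q'.1 →
      ∑ k ∈ Finset.range (q.2 + 1), τ (q.1, k) ≠ ∑ k ∈ Finset.range (q'.2 + 1), τ (q'.1, k) := by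
    simp only [ae_all_iff]
    intro q q' h
    rw [ae_iff]
    simpa using timeLaw_tie_eq_zero h q.2 q'.2
  filter_upwards [ae_timeLaw_pos, ae_timeLaw_tendsto_sum, htie] with τ hpos hlim htie
  constructor
  · intro t
    have hfin : ∀ e, {n : ℕ | ∑ k ∈ Finset.range (n + 1), τ (e, k) ≤ t}.Finite := by
      intro e
      have h := ((tendsto_add_atTop_iff_nat 1).2 (hlim e)).eventually_gt_atTop t
      rw [← Nat.cofinite_eq_atTop, eventually_cofinite] at h
      simpa using h
    refine (Set.finite_iUnion fun e => (hfin e).image (Prod.mk e)).subset ?_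
    rintro ⟨e, n⟩ h
    exact Set.mem_iUnion.2 ⟨e, n, h, rfl⟩
  · rintro ⟨e, n⟩ ⟨e', m⟩ h
    by_cases he : e = e'
    · subst he
      have hmono : StrictMono fun n => ∑ k ∈ Finset.range (n + 1), τ (e, k) :=
        strictMono_nat_of_lt_succ fun n => by
          rw [Finset.sum_range_succ _ (n + 1)]
          linarith [hpos (e, n + 1)]
      exact congrArg (Prod.mk e) (hmono.injective h)
    · exact absurd h (htie (e, n) (e', m) he)

end InterarrivalTimes

/-! ### Listing a locally finite set of times in increasing order. -/

section Enumeration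

/-- An infinite locally finite family of distinct times can be listed in increasing order. -/
lemma exists_bijective_strictMono {P : Type*} [Infinite P] {T : P → ℝ}
    (hfin : ∀ t, {q | T q ≤ t}.Finite) (hinj : Function.Injective T) :
    ∃ p : ℕ → P, Function.Bijective p ∧ StrictMono (T ∘ p) := by
  classical
  -- The rank is finite by local finiteness and strictly increasing in `T`, so listing its range in
  -- order lists `P` by time.
  set rank : P → ℕ := fun q => {r | T r ≤ T q}.ncard with hrank
  have hlt : ∀ q q', T q < T q' → rank q < rank q' := fun q q' h =>
    Set.ncard_lt_ncard ⟨fun r hr => le_trans hr h.le, fun hsub => h.not_ge (hsub (le_refl (T q')))⟩ (hfin _)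
  have hri : Function.Injective rank := by
    intro q q' h
    rcases lt_trichotomy (T q) (T q') with h' | h' | h'
    · exact absurd h (hlt _ _ h').ne
    · exact hinj h'
    · exact absurd h (hlt _ _ h').ne'
  have : Infinite (Set.range rank) := (Set.infinite_range_of_injective hri).to_subtype
  set F := Nat.Subtype.orderIsoOfNat (Set.range rank)
  set R := Equiv.ofInjective rank hri
  refine ⟨fun n => R.symm (F n), R.symm.bijective.comp F.bijective, fun n m h => ?_⟩
  have hFR : ∀ n, rank (R.symm (F n)) = F n := fun n =>
    congrArg Subtype.val (R.apply_symm_apply (F n))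
  have hrk : rank (R.symm (F n)) < rank (R.symm (F m)) := by
    rw [hFR, hFR]
    exact F.strictMono h
  by_contra hge
  rcases (not_lt.1 hge).lt_or_eq with h' | h'
  · exact (hlt _ _ h').not_gt hrk
  · have h'' : T (R.symm (F m)) = T (R.symm (F n)) := h'
    rw [hinj h''] at hrk
    exact lt_irrefl _ hrk

lemma exists_lt_iff_le_of_strictMono {P : Type*} {T : P → ℝ} (hfin : ∀ t, {q | T q ≤ t}.Finite)
    {p : ℕ → P} (hp : Function.Injective p) (hmono : StrictMono (T ∘ p)) (t : ℝ) :
    ∃ k, ∀ n, n < k ↔ T (p n) ≤ t := by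
  classical
  have hex : ∃ n, t < T (p n) := by
    by_contra! h
    exact Set.infinite_range_of_injective hp ((hfin t).subset (by rintro _ ⟨n, rfl⟩; exact h n))
  refine ⟨Nat.find hex, fun n => ⟨fun h => not_lt.1 (Nat.find_min hex h), fun h => ?_⟩⟩
  by_contra hge
  exact ((Nat.find_spec hex).trans_le (hmono.monotone (not_lt.1 hge))).not_ge h

lemma frequently_fst_eq {E : Type*} {p : ℕ → E × ℕ} (hp : Function.Surjective p) (e : E) :
    ∃ᶠ k in atTop, (p k).1 = e := by
  rw [Nat.frequently_atTop_iff_infinite]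
  refine Set.Infinite.of_image p ((Set.infinite_range_of_injective
    (Prod.mk_right_injective e)).mono ?_)
  rintro _ ⟨n, rfl⟩
  obtain ⟨k, hk⟩ := hp (e, n)
  exact ⟨k, by simp [hk], hk⟩

end Enumeration

/-! ### Uniqueness of the chronological list. -/

section Arrivals

variable {G : SimpleGraph V}

/-- Two sorted permutations of each other coincide when the times are distinct; strictness in `hl`
excludes ties. -/
lemma arrivals_eq {ω : Sample G} {t : ℝ≥0} {l : List (G.edgeSet × ℕ)}
    (hl : l.Pairwise fun p q => arrivalTime ω p < arrivalTime ω q)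
    (hmem : ∀ q, q ∈ l ↔ arrivalTime ω q ≤ t) : arrivals ω t = l := by
  classical
  have hset : {p | arrivalTime ω p ≤ t} = {p | p ∈ l} := Set.ext fun q => (hmem q).symm
  have hfin : {p | arrivalTime ω p ≤ t}.Finite := hset ▸ l.finite_toSet
  have : Std.Total fun p q : G.edgeSet × ℕ => arrivalTime ω p ≤ arrivalTime ω q :=
    ⟨fun _ _ => le_total _ _⟩
  have : IsTrans (G.edgeSet × ℕ) fun p q => arrivalTime ω p ≤ arrivalTime ω q :=
    ⟨fun _ _ _ => le_trans⟩
  have hperm : (arrivals ω t).Perm l := by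
    rw [arrivals, dif_pos hfin]
    refine (List.perm_insertionSort _ _).trans ((List.perm_ext_iff_of_nodup
      (Finset.nodup_toList _) (hl.imp fun h heq => h.ne (congrArg _ heq))).2 fun q => ?_)
    rw [Finset.mem_toList, Set.Finite.mem_toFinset, hmem, Set.mem_ofPred_eq]
  refine hperm.eq_of_pairwise (le := fun p q => arrivalTime ω p ≤ arrivalTime ω q) ?_ ?_
    (hl.imp le_of_lt)
  · intro a b ha hb hab hba
    by_contra hne
    have : Std.Symm fun p q : G.edgeSet × ℕ => arrivalTime ω p ≠ arrivalTime ω q :=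
      ⟨fun _ _ => Ne.symm⟩
    exact (hl.imp ne_of_lt).forall (hperm.mem_iff.1 ha) hb hne (le_antisymm hab hba)
  · rw [arrivals, dif_pos hfin]
    exact List.pairwise_insertionSort _ _

end Arrivals

variable {G : SimpleGraph V}

/-! ### From continuous time to the chain. -/

section Regular

/-- The arrivals are locally finite and no two of them are simultaneous. -/
def IsRegular {E : Type*} (τ : E × ℕ → ℝ) : Prop :=
  (∀ t : ℝ, {q : E × ℕ | ∑ k ∈ Finset.range (q.2 + 1), τ (q.1, k) ≤ t}.Finite) ∧
    Function.Injective fun q : E × ℕ => ∑ k ∈ Finset.range (q.2 + 1), τ (q.1, k)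

lemma ae_isRegular [Fintype V] : ∀ᵐ ω ∂law G, IsRegular ω.2.1 :=
  (Measure.quasiMeasurePreserving_fst.comp Measure.quasiMeasurePreserving_snd).ae
    ae_timeLaw_locallyFinite_injective

/-- For regular arrivals, the process is a time change of the chain of its successive
configurations. -/
lemma IsRegular.exists_process_eq_chain [Nonempty G.edgeSet] {τ : G.edgeSet × ℕ → ℝ}
    (h : IsRegular τ) (o : EdgeOrientation G) (ε : ℝ) :
    ∃ (p : ℕ → G.edgeSet × ℕ) (k : ℝ≥0 → ℕ), Function.Bijective p ∧ Monotone k ∧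
      Tendsto k atTop atTop ∧
      ∀ η u t, process o ε t (η, τ, u) = chain o ε p η u (k t) := by
  obtain ⟨p, hp, hmono⟩ := exists_bijective_strictMono h.1 h.2
  choose k hk using fun t : ℝ≥0 => exists_lt_iff_le_of_strictMono h.1 hp.injective hmono t
  refine ⟨p, k, hp, fun s t hst => ?_, tendsto_atTop.2 fun n => ?_, fun η u t => ?_⟩
  · exact le_of_forall_lt fun n hn => (hk t n).2 (((hk s n).1 hn).trans (NNReal.coe_le_coe.2 hst))
  · filter_upwards [eventually_ge_atTop
      (∑ k ∈ Finset.range ((p n).2 + 1), τ ((p n).1, k)).toNNReal] with t ht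
    exact ((hk t n).2 (Real.toNNReal_le_iff_le_coe.1 ht)).le
  · have harr : arrivals ((η, τ, u) : Sample G) t = (List.range (k t)).map p := by
      refine arrivals_eq (List.pairwise_map.2 (List.pairwise_lt_range.imp fun h => hmono h))
        fun q => ?_
      obtain ⟨n, rfl⟩ := hp.surjective q
      rw [List.mem_map_of_injective hp.injective, List.mem_range]
      exact hk t n
    unfold process
    rw [harr]
    exact foldl_map_range_eq_chain o ε p η u (k t)

/-- Consensus is absorbing, because the set of opinions only shrinks. -/
lemma mem_consensus_iff_of_eq_chain {o : EdgeOrientation G} {ε : ℝ} {p : ℕ → G.edgeSet × ℕ}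
    {k : ℝ≥0 → ℕ} (hk : Tendsto k atTop atTop) {ω : Sample G}
    (h : ∀ t, process o ε t ω = chain o ε p ω.1 ω.2.2 (k t)) :
    ω ∈ consensus o ε ↔ ∃ n, IsConsensus (chain o ε p ω.1 ω.2.2 n) := by
  constructor
  · intro hω
    obtain ⟨t, ht⟩ := Eventually.exists (f := atTop) hω
    exact ⟨k t, h t ▸ ht⟩
  · rintro ⟨n, hn⟩
    change ∀ᶠ t in atTop, IsConsensus (process o ε t ω)
    filter_upwards [hk.eventually_ge_atTop n] with t ht
    rw [h t]
    intro x y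
    have hsub := range_chain_antitone o ε p ω.1 ω.2.2 ht
    obtain ⟨x', hx'⟩ := hsub ⟨x, rfl⟩
    obtain ⟨y', hy'⟩ := hsub ⟨y, rfl⟩
    rw [← hx', ← hy']
    exact hn x' y'

/-- The number of opinions is a nonincreasing function of time with values in `ℕ`. -/
lemma IsRegular.tendsto_numOpinions [Finite V] [Nonempty G.edgeSet] {ω : Sample G}
    (h : IsRegular ω.2.1) (o : EdgeOrientation G) (ε : ℝ) :
    Tendsto (fun t => numOpinions (process o ε t ω)) atTop (𝓝 (limitOpinions o ε ω)) := by
  obtain ⟨p, k, -, hk, -, hproc⟩ := h.exists_process_eq_chain o ε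
  have hanti : Antitone fun t => numOpinions (process o ε t ω) := by
    intro s t hst
    have := numOpinions_chain_antitone o ε p ω.1 ω.2.2 (hk hst)
    simp only [← hproc] at this
    exact this
  exact tendsto_nhds_limUnder ⟨_, tendsto_atTop_ciInf hanti (OrderBot.bddBelow _)⟩

lemma mem_consensus_iff_limitOpinions_eq_one [Nonempty V] {o : EdgeOrientation G} {ε : ℝ}
    {ω : Sample G}
    (h : Tendsto (fun t => numOpinions (process o ε t ω)) atTop (𝓝 (limitOpinions o ε ω))) :
    ω ∈ consensus o ε ↔ limitOpinions o ε ω = 1 := by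
  have hev : ∀ᶠ t in atTop, numOpinions (process o ε t ω) = limitOpinions o ε ω := by
    rw [nhds_discrete] at h
    exact tendsto_pure.1 h
  constructor
  · intro hω
    obtain ⟨t, ht, ht'⟩ := (Eventually.and (f := atTop) hω hev).exists
    rw [← ht', isConsensus_iff_numOpinions_eq_one.1 ht]
  · intro h1
    change ∀ᶠ t in atTop, IsConsensus (process o ε t ω)
    filter_upwards [hev] with t ht
    exact isConsensus_iff_numOpinions_eq_one.2 (ht.trans h1)

end Regular

/-! ### A measurable version of the consensus event. -/

section Measurability

variable (o : EdgeOrientation G) (ε : ℝ)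

/-- The event that the arrivals up to time `t` are those of the list `l`, in this order, and lead
to a consensus. -/
def consensusAlong (t : ℝ≥0) (l : List (G.edgeSet × ℕ)) : Set (Sample G) :=
  {ω | l.Pairwise fun p q => arrivalTime ω p < arrivalTime ω q} ∩
    (⋂ q, {ω | q ∈ l ↔ arrivalTime ω q ≤ t}) ∩
    {ω | IsConsensus (l.foldl
      (fun η p => interact ε (o.dart p.1).fst (o.dart p.1).snd (ω.2.2 p) η) ω.1)}

lemma measurable_arrivalTime (q : G.edgeSet × ℕ) :
    Measurable fun ω : Sample G => arrivalTime ω q :=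
  Finset.measurable_sum _ fun _ _ =>
    (measurable_pi_apply _).comp (measurable_fst.comp measurable_snd)

lemma measurableSet_pairwise_arrivalTime (l : List (G.edgeSet × ℕ)) :
    MeasurableSet {ω : Sample G | l.Pairwise fun p q => arrivalTime ω p < arrivalTime ω q} := by
  induction l with
  | nil => simp
  | cons a l ih =>
    have hcons : {ω : Sample G | (a :: l).Pairwise fun p q => arrivalTime ω p < arrivalTime ω q} =
        (⋂ b ∈ {b | b ∈ l}, {ω | arrivalTime ω a < arrivalTime ω b}) ∩
          {ω | l.Pairwise fun p q => arrivalTime ω p < arrivalTime ω q} := by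
      ext
      simp
    rw [hcons]
    exact (MeasurableSet.biInter l.finite_toSet.countable fun b _ =>
      measurableSet_lt (measurable_arrivalTime a) (measurable_arrivalTime b)).inter ih

lemma measurable_foldl_interact {Ω : Type*} [MeasurableSpace Ω] (l : List (G.edgeSet × ℕ))
    {g : Ω → Config V} (hg : Measurable g) {c : Ω → G.edgeSet × ℕ → Bool} (hc : Measurable c) :
    Measurable fun ω => l.foldl
      (fun η p => interact ε (o.dart p.1).fst (o.dart p.1).snd (c ω p) η) (g ω) := by
  induction l generalizing g with
  | nil => exact hg
  | cons a l ih => exact ih (Measurable.interact hg ((measurable_pi_apply a).comp hc) ..)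

lemma measurableSet_consensusAlong [Fintype V] (t : ℝ≥0) (l : List (G.edgeSet × ℕ)) :
    MeasurableSet (consensusAlong o ε t l) := by
  refine ((measurableSet_pairwise_arrivalTime l).inter (MeasurableSet.iInter fun q => ?_)).inter
    (measurable_foldl_interact o ε l measurable_fst (measurable_snd.comp measurable_snd)
      measurableSet_isConsensus)
  have hle : MeasurableSet {ω : Sample G | arrivalTime ω q ≤ t} :=
    measurableSet_le (measurable_arrivalTime q) measurable_const
  by_cases hq : q ∈ l
  · simpa [hq] using hle
  · simpa [hq] using measurableSet_lt (measurable_const (a := (t : ℝ))) (measurable_arrivalTime q)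

lemma IsRegular.mem_arrivals {ω : Sample G} (h : IsRegular ω.2.1) (t : ℝ≥0) (q : G.edgeSet × ℕ) :
    q ∈ arrivals ω t ↔ arrivalTime ω q ≤ t := by
  have hfin : {p | arrivalTime ω p ≤ t}.Finite := h.1 t
  rw [arrivals, dif_pos hfin, List.mem_insertionSort, Finset.mem_toList, Set.Finite.mem_toFinset,
    Set.mem_ofPred_eq]

lemma IsRegular.pairwise_arrivals {ω : Sample G} (h : IsRegular ω.2.1) (t : ℝ≥0) :
    (arrivals ω t).Pairwise fun p q => arrivalTime ω p < arrivalTime ω q := by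
  classical
  have hfin : {p | arrivalTime ω p ≤ t}.Finite := h.1 t
  have : Std.Total fun p q : G.edgeSet × ℕ => arrivalTime ω p ≤ arrivalTime ω q :=
    ⟨fun _ _ => le_total _ _⟩
  have : IsTrans (G.edgeSet × ℕ) fun p q => arrivalTime ω p ≤ arrivalTime ω q :=
    ⟨fun _ _ _ => le_trans⟩
  rw [arrivals, dif_pos hfin]
  have hnodup := (List.perm_insertionSort (fun p q => arrivalTime ω p ≤ arrivalTime ω q)
    hfin.toFinset.toList).nodup_iff.2 (Finset.nodup_toList _)
  exact ((List.pairwise_insertionSort _ _).and hnodup).imp fun hpq =>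
    lt_of_le_of_ne hpq.1 fun heq => hpq.2 (h.2 heq)

/-- Since consensus is absorbing, integer times suffice, and the history up to such a time is a
finite list of arrivals. With finitely many vertices this makes the union countable. -/
lemma IsRegular.mem_consensus_iff [Nonempty G.edgeSet] {ω : Sample G} (h : IsRegular ω.2.1) :
    ω ∈ consensus o ε ↔ ω ∈ ⋃ n : ℕ, ⋃ l, consensusAlong o ε n l := by
  obtain ⟨p, k, -, -, hk, hproc⟩ := h.exists_process_eq_chain o ε
  have hproc' : ∀ t, process o ε t ω = chain o ε p ω.1 ω.2.2 (k t) := fun t => hproc ω.1 ω.2.2 t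
  simp only [Set.mem_iUnion]
  constructor
  · intro hω
    obtain ⟨n, hn⟩ := (tendsto_natCast_atTop_atTop (R := ℝ≥0)).eventually
      (show ∀ᶠ t in atTop, IsConsensus (process o ε t ω) from hω) |>.exists
    exact ⟨n, arrivals ω n, ⟨h.pairwise_arrivals n, Set.mem_iInter.2 (h.mem_arrivals n)⟩, hn⟩
  · rintro ⟨n, l, ⟨h1, h2⟩, h3⟩
    rw [mem_consensus_iff_of_eq_chain hk hproc']
    refine ⟨k n, ?_⟩
    rw [← hproc']
    unfold process
    rw [arrivals_eq h1 fun q => Set.mem_iInter.1 h2 q]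
    exact h3

lemma consensus_ae_eq [Fintype V] [Nonempty G.edgeSet] :
    consensus o ε =ᵐ[law G] (⋃ n : ℕ, ⋃ l, consensusAlong o ε n l : Set (Sample G)) := by
  filter_upwards [ae_isRegular] with ω hω
  exact propext (hω.mem_consensus_iff o ε)

lemma measurableSet_iUnion_consensusAlong [Fintype V] :
    MeasurableSet (⋃ n : ℕ, ⋃ l, consensusAlong o ε n l) :=
  MeasurableSet.iUnion fun _ => MeasurableSet.iUnion fun _ => measurableSet_consensusAlong ..

end Measurability

/-! ### Averaging over initial opinions and arrival times. -/

section LowerBound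

variable {ε : ℝ}

open Classical in
-- Each vertex is central with probability `2 * ε - 1`, the length of `[1 - ε, ε]` inside `[0, 1]`.
lemma integral_total_central [Fintype V] (hε : 1 / 2 < ε) (hε' : ε ≤ 1) :
    ∫ η, total (fun a => if (a : ℝ) ∈ Set.Icc (1 - ε) ε then 1 else 0) η
      ∂(Measure.pi fun _ : V => (volume : Measure I)) = Fintype.card V * (2 * ε - 1) := by
  set f : I → ℝ := fun a => if (a : ℝ) ∈ Set.Icc (1 - ε) ε then 1 else 0 with hf
  have hmem : 1 - ε ∈ I := ⟨by linarith, by linarith⟩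
  have hmem' : ε ∈ I := ⟨by linarith, hε'⟩
  set S : Set I := Set.Icc ⟨1 - ε, hmem⟩ ⟨ε, hmem'⟩
  have hfS : f = S.indicator 1 := by
    funext a
    by_cases ha : a ∈ S
    · rw [Set.indicator_of_mem ha]
      exact if_pos ha
    · rw [Set.indicator_of_notMem ha]
      exact if_neg ha
  have hone : ∫ a, f a = 2 * ε - 1 := by
    rw [hfS, integral_indicator_one measurableSet_Icc, measureReal_def, unitInterval.volume_Icc,
      ENNReal.toReal_ofReal] <;> simp only [] <;> linarith
  have hfm : Measurable f := hfS ▸ measurable_one.indicator measurableSet_Icc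
  have heval : ∀ x : V, ∫ η, f (η x) ∂(Measure.pi fun _ : V => (volume : Measure I)) =
      2 * ε - 1 := by
    intro x
    have hmp := measurePreserving_eval (fun _ : V => (volume : Measure I)) x
    have hmap := integral_map (f := f) hmp.aemeasurable hfm.aestronglyMeasurable
    rw [hmp.map_eq, hone] at hmap
    exact hmap.symm
  unfold total
  rw [integral_finsetSum]
  · simp only [heval, Finset.sum_const, Finset.card_univ, nsmul_eq_mul]
  · intro x _
    refine Integrable.of_bound (hfm.comp (measurable_pi_apply x)).aestronglyMeasurable 1
      (Eventually.of_forall fun η => ?_)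
    simp only [hf]
    split_ifs <;> simp

lemma le_law_consensus [Fintype V] [Nonempty G.edgeSet] (hG : G.Connected) (o : EdgeOrientation G)
    (hε : 1 / 2 < ε) (hε' : ε ≤ 1) : 2 * ε - 1 ≤ (law G).real (consensus o ε) := by
  classical
  have : Nonempty V := hG.nonempty
  have hcard : (0 : ℝ) < Fintype.card V := Nat.cast_pos.2 Fintype.card_pos
  set f : I → ℝ := fun a => if (a : ℝ) ∈ Set.Icc (1 - ε) ε then 1 else 0 with hf
  have hf0 : ∀ η : Config V, 0 ≤ total f η := fun η =>
    Finset.sum_nonneg fun x _ => by simp only [hf]; split_ifs <;> simp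
  have hfm : Measurable f :=
    Measurable.ite (measurable_subtype_coe measurableSet_Icc) measurable_const measurable_const
  have hint : Integrable (fun η : Config V => total f η / Fintype.card V)
      (Measure.pi fun _ : V => (volume : Measure I)) :=
    (Integrable.of_bound (measurable_total hfm).aestronglyMeasurable (Fintype.card V)
      (Eventually.of_forall fun η => abs_total_le
        (fun a => by simp only [hf]; split_ifs <;> simp) η)).div_const _
  -- Slicing the product measure needs a measurable set, so the measurable version replaces
  -- `consensus o ε` until the end.
  set A : Set (Sample G) := ⋃ n : ℕ, ⋃ l, consensusAlong o ε n l with hA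
  have hAm : MeasurableSet A := measurableSet_iUnion_consensusAlong o ε
  have hsec : ∀ η τ, IsRegular τ → ENNReal.ofReal (total f η / Fintype.card V) ≤
      coinLaw (G.edgeSet × ℕ) (Prod.mk τ ⁻¹' (Prod.mk η ⁻¹' A)) := by
    intro η τ hτ
    obtain ⟨p, k, hp, -, hk, hproc⟩ := hτ.exists_process_eq_chain o ε
    have hset : Prod.mk τ ⁻¹' (Prod.mk η ⁻¹' A) = {u | ∃ n, IsConsensus (chain o ε p η u n)} := by
      ext u
      rw [Set.mem_preimage, Set.mem_preimage, hA,
        ← IsRegular.mem_consensus_iff o ε (ω := (η, τ, u)) hτ]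
      exact mem_consensus_iff_of_eq_chain (ω := (η, τ, u)) hk (hproc η u)
    rw [hset]
    refine ENNReal.ofReal_le_of_le_toReal ((div_le_iff₀' hcard).2 ?_)
    exact card_le_mul_coinLaw_consensus hG hp.injective (frequently_fst_eq hp.surjective)
  have hle : ENNReal.ofReal (2 * ε - 1) ≤ law G A := by
    calc ENNReal.ofReal (2 * ε - 1)
        = ∫⁻ η, ENNReal.ofReal (total f η / Fintype.card V)
            ∂(Measure.pi fun _ : V => (volume : Measure I)) := by
          rw [← ofReal_integral_eq_lintegral_ofReal hint
            (Eventually.of_forall fun η => div_nonneg (hf0 η) hcard.le), integral_div,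
            integral_total_central hε hε', mul_div_cancel_left₀ _ hcard.ne']
      _ ≤ ∫⁻ η, ((timeLaw (G.edgeSet × ℕ)).prod (coinLaw (G.edgeSet × ℕ))) (Prod.mk η ⁻¹' A)
            ∂(Measure.pi fun _ : V => (volume : Measure I)) := by
          refine lintegral_mono fun η => ?_
          rw [Measure.prod_apply (measurable_prodMk_left hAm)]
          calc ENNReal.ofReal (total f η / Fintype.card V)
              = ∫⁻ _, ENNReal.ofReal (total f η / Fintype.card V) ∂timeLaw (G.edgeSet × ℕ) := by
                rw [lintegral_const, measure_univ, mul_one]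
            _ ≤ _ := by
                refine lintegral_mono_ae ?_
                filter_upwards [ae_timeLaw_locallyFinite_injective] with τ hτ
                exact hsec η τ hτ
      _ = law G A := (Measure.prod_apply hAm).symm
  rw [measureReal_congr (consensus_ae_eq o ε)]
  exact (ENNReal.ofReal_le_iff_le_toReal (measure_ne_top _ _)).1 hle

end LowerBound

end ThresholdVoter

theorem theorem3 {V : Type*} [Fintype V] (G : SimpleGraph V) (hG : G.Connected)
    (o : ThresholdVoter.EdgeOrientation G) (ε : ℝ) (hε : 1 / 2 < ε) (hε' : ε ≤ 1) :
    (∀ᵐ ω ∂ThresholdVoter.law G,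
      Tendsto (fun t => ThresholdVoter.numOpinions (ThresholdVoter.process o ε t ω)) atTop
        (𝓝 (ThresholdVoter.limitOpinions o ε ω))) ∧
    NullMeasurableSet (ThresholdVoter.consensus o ε) (ThresholdVoter.law G) ∧
    (ThresholdVoter.law G).real (ThresholdVoter.consensus o ε) =
      (ThresholdVoter.law G).real {ω | ThresholdVoter.limitOpinions o ε ω = 1} ∧
    2 * ε - 1 ≤ (ThresholdVoter.law G).real (ThresholdVoter.consensus o ε) := by
  open ThresholdVoter in
  have hV : Nonempty V := hG.nonempty
  -- Without edges there are no arrivals to enumerate, but connectedness then leaves a single vertex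
  -- and consensus is trivial.
  rcases isEmpty_or_nonempty G.edgeSet with hE | hE
  · have hsub : ∀ η : Config V, IsConsensus η := by
      intro η x y
      obtain ⟨W⟩ := hG.preconnected x y
      cases W with
      | nil => rfl
      | cons h _ => exact (hE.false ⟨s(_, _), h⟩).elim
    have htend : ∀ ω, Tendsto (fun t => numOpinions (process o ε t ω)) atTop
        (𝓝 (limitOpinions o ε ω)) := fun ω =>
      tendsto_nhds_limUnder ⟨1, tendsto_const_nhds.congr fun t =>
        (isConsensus_iff_numOpinions_eq_one.1 (hsub _)).symm⟩
    have huniv : consensus o ε = Set.univ := Set.eq_univ_of_forall fun ω =>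
      Eventually.of_forall fun t => hsub _
    have hset : consensus o ε = {ω | limitOpinions o ε ω = 1} := Set.ext fun ω =>
      mem_consensus_iff_limitOpinions_eq_one (htend ω)
    refine ⟨Eventually.of_forall htend, huniv ▸ nullMeasurableSet_univ, by rw [hset], ?_⟩
    rw [huniv, probReal_univ]
    linarith
  · have htend : ∀ᵐ ω ∂law G, Tendsto (fun t => numOpinions (process o ε t ω)) atTop
        (𝓝 (limitOpinions o ε ω)) := by
      filter_upwards [ae_isRegular] with ω hω using hω.tendsto_numOpinions o ε
    refine ⟨htend, ⟨_, measurableSet_iUnion_consensusAlong o ε, consensus_ae_eq o ε⟩,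
      measureReal_congr ?_, le_law_consensus hG o hε hε'⟩
    filter_upwards [htend] with ω hω
    exact propext (mem_consensus_iff_limitOpinions_eq_one hω)
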